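/- Let $k$ be a perfect field of characteristic $p>0$. **Perfect schemes and inverse perfection.** A scheme $X$ over $\mathbb F_p$ is called *perfect* if its absolute Frobenius $F_X\colon X\to X$ (the identity on the underlying space, $a\mapsto a^p$ on the structure sheaf) is an isomorphism. Let $(\mathrm{Sch}/k)$ be the category of $k$-schemes and $(\mathrm{Perf}/k)$ its full subcategory of perfect $k$-schemes. For a $k$-scheme $Y$, the *inverse perfection* of $Y$ is the perfect scheme $Y^{\mathrm{pf}}$ obtained by gluing the spectra of the rings $A^{\mathrm{pf}}=\varinjlim(A\xrightarrow{a\mapsto a^p}A\xrightarrow{a\mapsto a^p}\cdots)$, where $\operatorname{Spec}A$ runs through the affine open subschemes of $Y$. It comes with a canonical morphism $\varphi_Y\colon Y^{\mathrm{pf}}\to Y$ through which every morphism from a perfect $\mathbb F_p$-scheme to $Y$ factors uniquely, and it is regarded as a $k$-scheme via $Y^{\mathrm{pf}}\to Y\to\operatorname{Spec}k$. This defines a functor $(\mathrm{Sch}/k)\to(\mathrm{Perf}/k)$ which commutes with products, so that it sends (not necessarily commutative) $k$-group schemes and their homomorphisms to group objects of $(\mathrm{Perf}/k)$ and their homomorphisms.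 **Topologies and exactness.** An fpqc covering of a scheme $X$ is a jointly surjective family of flat morphisms $\{X_\alpha\to X\}$ such that every quasi-compact open subset of $X$ is the image of a quasi-compact open subset of $\coprod_\alpha X_\alpha$. A family of morphisms with common target in $(\mathrm{Sch}/k)$, respectively $(\mathrm{Perf}/k)$, is an fpqc covering if the underlying family of morphisms of schemes is one; this defines the fpqc topology on each of these categories. For $\mathcal C=(\mathrm{Sch}/k)$ or $\mathcal C=(\mathrm{Perf}/k)$, a sequence $1\to F\to G\to H\to 1$ of group objects of $\mathcal C$ is *exact for the fpqc topology on $\mathcal C$* if 1. for every object $T$ of $\mathcal C$, the homomorphism $F(T)\to G(T)$ is injective with image the kernel of $G(T)\to H(T)$, where $X(T)=\operatorname{Hom}_{\mathcal C}(T,X)$, and 2. the morphism of presheaves $\operatorname{Hom}_{\mathcal C}(-,G)\to\operatorname{Hom}_{\mathcal C}(-,H)$ is locally surjective for the fpqc topology on $\mathcal C$, i.e. for every object $T$ of $\mathcal C$ and every $s\in H(T)$ there is an fpqc covering $\{T_\alpha\to T\}$ in $\mathcal C$ such that each $s|_{T_\alpha}$ lies in the image of $G(T_\alpha)\to H(T_\alpha)$.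 **Theorem.** If $1\to F\to G\to H\to 1$ is a sequence of $k$-group schemes which is exact for the fpqc topology on $(\mathrm{Sch}/k)$, then the induced sequence $$1\to F^{\mathrm{pf}}\to G^{\mathrm{pf}}\to H^{\mathrm{pf}}\to 1$$ is exact for the fpqc topology on $(\mathrm{Perf}/k)$. -/

import Mathlib

open CategoryTheory Limits AlgebraicGeometry Opposite

universe u

namespace InversePerfection

section Rings

/-- A commutative ring in which `p = 0`, i.e. an `𝔽_p`-algebra (the zero ring included). -/
class IsFpRing (p : ℕ) (A : Type u) [CommRing A] : Prop where
  cast_eq_zero : (p : A) = 0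

lemma IsFpRing.of_ringHom {p : ℕ} {A B : Type u} [CommRing A] [CommRing B] [IsFpRing p A]
    (f : A →+* B) : IsFpRing p B :=
  ⟨by rw [← map_natCast f p, IsFpRing.cast_eq_zero, map_zero]⟩

/-- The Frobenius endomorphism `a ↦ a ^ p` of an `𝔽_p`-algebra. -/
def frob (p : ℕ) [hp : Fact p.Prime] (A : Type u) [CommRing A] [IsFpRing p A] : A →+* A where
  toFun a := a ^ p
  map_one' := one_pow p
  map_mul' a b := mul_pow a b p
  map_zero' := zero_pow hp.out.ne_zero
  map_add' a b := by
    obtain ⟨r, hr⟩ := exists_add_pow_prime_eq hp.out a b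
    rw [hr, IsFpRing.cast_eq_zero, zero_mul, zero_mul, zero_mul, add_zero]

variable (p : ℕ) [hp : Fact p.Prime]

@[simp]
lemma frob_apply (A : Type u) [CommRing A] [IsFpRing p A] (a : A) : frob p A a = a ^ p := rfl

/-- The iterates `F_A ^ n : a ↦ a ^ (p ^ n)` of the Frobenius endomorphism. -/
def frobPow (A : Type u) [CommRing A] [IsFpRing p A] : ℕ → (A →+* A)
  | 0 => RingHom.id A
  | n + 1 => (frob p A).comp (frobPow A n)

@[simp]
lemma frobPow_apply (A : Type u) [CommRing A] [IsFpRing p A] (n : ℕ) (a : A) :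
    frobPow p A n a = a ^ p ^ n := by
  induction n with
  | zero => simp [frobPow]
  | succ n ih => simp [frobPow, ih, pow_succ p, pow_mul]

instance (A : Type u) [CommRing A] [IsFpRing p A] :
    DirectedSystem (fun _ : ℕ => A) (fun i j (_ : i ≤ j) => (frobPow p A (j - i) : A → A)) where
  map_self i x := by simp
  map_map i j k hij hjk x := by
    simp only [frobPow_apply, ← pow_mul, ← pow_add]
    congr 2
    omega

/-- The perfect closure `A^pf`: the inductive limit of the system `A → A → A → ⋯`, indexed by `ℕ`,
all of whose transition maps are equal to the Frobenius endomorphism of `A`. -/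
def RingPf (A : Type u) [CommRing A] [IsFpRing p A] : Type u :=
  DirectLimit (fun _ : ℕ => A) (fun i j (_ : i ≤ j) => frobPow p A (j - i))

noncomputable instance (A : Type u) [CommRing A] [IsFpRing p A] : CommRing (RingPf p A) :=
  inferInstanceAs (CommRing (DirectLimit (fun _ : ℕ => A)
    (fun i j (_ : i ≤ j) => frobPow p A (j - i))))

variable {A B C : Type u} [CommRing A] [IsFpRing p A] [CommRing B] [IsFpRing p B]
  [CommRing C] [IsFpRing p C]

/-- The map of the `n`-th term of the inductive system to the limit `A^pf`. -/
noncomputable def ringPfι (n : ℕ) : A →+* RingPf p A where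
  toFun a := ⟦⟨n, a⟩⟧
  map_one' := (DirectLimit.one_def
    (f := fun i j (_ : i ≤ j) => frobPow p A (j - i)) n).symm
  map_mul' a b := (DirectLimit.mul_def
    (f := fun i j (_ : i ≤ j) => frobPow p A (j - i)) n a b).symm
  map_zero' := (DirectLimit.zero_def
    (f := fun i j (_ : i ≤ j) => frobPow p A (j - i)) n).symm
  map_add' a b := (DirectLimit.add_def
    (f := fun i j (_ : i ≤ j) => frobPow p A (j - i)) n a b).symm

/-- The canonical map `φ_A : A → A^pf`. -/
noncomputable def toRingPf (A : Type u) [CommRing A] [IsFpRing p A] : A →+* RingPf p A :=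
  ringPfι p 0

instance : IsFpRing p (RingPf p A) := .of_ringHom (toRingPf p A)

lemma ringPfι_add_pow (n m : ℕ) (a : A) :
    ringPfι p (n + m) (a ^ p ^ m) = ringPfι p n a := by
  have h := DirectLimit.eq_of_le (F := fun _ : ℕ => A)
    (f := fun i j (_ : i ≤ j) => frobPow p A (j - i)) ⟨n, a⟩ (n + m) (n.le_add_right m)
  rw [frobPow_apply] at h
  simp only [Nat.add_sub_cancel_left] at h
  exact h.symm

lemma ringPfι_pow (n : ℕ) (a : A) : (ringPfι p n a) ^ p ^ n = toRingPf p A a := by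
  rw [← map_pow, toRingPf, ← ringPfι_add_pow p 0 n, zero_add]

lemma exists_ringPfι (x : RingPf p A) : ∃ n a, ringPfι p n a = x := by
  obtain ⟨n, a, h⟩ := DirectLimit.exists_eq_mk _ x
  exact ⟨n, a, h.symm⟩

lemma exists_pow_eq_toRingPf (x : RingPf p A) : ∃ (n : ℕ) (a : A), x ^ p ^ n = toRingPf p A a := by
  obtain ⟨n, a, rfl⟩ := exists_ringPfι p x
  exact ⟨n, a, ringPfι_pow p n a⟩

lemma ringPfι_eq_zero (n : ℕ) (a : A) (h : ringPfι p n a = 0) : ∃ m, a ^ p ^ m = 0 := by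
  rw [← map_zero (ringPfι p n)] at h
  obtain ⟨k, hk, _, e⟩ := Quotient.eq.mp h
  exact ⟨k - n, by simpa [hp.out.ne_zero] using e⟩

lemma frob_ringPf_bijective : Function.Bijective (frob p (RingPf p A)) := by
  constructor
  · rw [injective_iff_map_eq_zero]
    intro x hx
    obtain ⟨n, a, rfl⟩ := exists_ringPfι p x
    rw [frob_apply, ← map_pow] at hx
    obtain ⟨m, hm⟩ := ringPfι_eq_zero p n _ hx
    rw [← ringPfι_add_pow p n (m + 1), pow_succ' p, pow_mul, hm, map_zero]
  · intro x
    obtain ⟨n, a, rfl⟩ := exists_ringPfι p x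
    refine ⟨ringPfι p (n + 1) a, ?_⟩
    rw [frob_apply, ← map_pow]
    simpa using ringPfι_add_pow p n 1 a

lemma frobPow_bijective (hB : Function.Bijective (frob p B)) (n : ℕ) :
    Function.Bijective (frobPow p B n) := by
  induction n with
  | zero => exact Function.bijective_id
  | succ n ih => exact hB.comp ih

lemma eq_of_pow_eq (hB : Function.Bijective (frob p B)) (n : ℕ) {x y : B}
    (h : x ^ p ^ n = y ^ p ^ n) : x = y :=
  (frobPow_bijective p hB n).1 (by simpa using h)

/-- Uniqueness in the universal property of the perfect closure. -/
lemma ringPf_hom_ext (hB : Function.Bijective (frob p B)) {f g : RingPf p A →+* B}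
    (h : f.comp (toRingPf p A) = g.comp (toRingPf p A)) : f = g := by
  ext x
  obtain ⟨n, a, ha⟩ := exists_pow_eq_toRingPf p x
  apply eq_of_pow_eq p hB n
  rw [← map_pow, ← map_pow, ha]
  exact congr($h a)

/-- Existence in the universal property of the perfect closure. -/
lemma exists_ringPf_lift (hB : Function.Bijective (frob p B)) (ψ : A →+* B) :
    ∃ f : RingPf p A →+* B, f.comp (toRingPf p A) = ψ := by
  let e (n : ℕ) : B ≃+* B := RingEquiv.ofBijective (frobPow p B n) (frobPow_bijective p hB n)
  have he (n : ℕ) (b : B) : ((e n).symm b) ^ p ^ n = b := by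
    have := (e n).apply_symm_apply b
    rwa [RingEquiv.ofBijective_apply, frobPow_apply] at this
  let l : RingPf p A → B := DirectLimit.lift _ (fun n a => (e n).symm (ψ a)) (by
    intro i j h a
    apply eq_of_pow_eq p hB j
    rw [he, frobPow_apply, map_pow]
    nth_rw 2 [← he i (ψ a)]
    rw [← pow_mul, ← pow_add]
    congr 2
    omega)
  have hl (n : ℕ) (a : A) : l (ringPfι p n a) = (e n).symm (ψ a) := rfl
  refine ⟨{ toFun := l, map_one' := ?_, map_mul' := ?_, map_zero' := ?_, map_add' := ?_ }, ?_⟩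
  · rw [← map_one (ringPfι p 0), hl, map_one, map_one]
  · exact DirectLimit.induction₂ _ fun n a b => by
      change l (ringPfι p n a * ringPfι p n b) = l (ringPfι p n a) * l (ringPfι p n b)
      rw [← map_mul, hl, hl, hl, map_mul, map_mul]
  · rw [← map_zero (ringPfι p 0), hl, map_zero, map_zero]
  · exact DirectLimit.induction₂ _ fun n a b => by
      change l (ringPfι p n a + ringPfι p n b) = l (ringPfι p n a) + l (ringPfι p n b)
      rw [← map_add, hl, hl, hl, map_add, map_add]
  · ext a
    change l (ringPfι p 0 a) = ψ a
    rw [hl]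
    have := he 0 (ψ a)
    simpa using this

/-- The map `f^pf : A^pf → B^pf` induced by `f : A → B`. -/
noncomputable def ringPfMap (f : A →+* B) : RingPf p A →+* RingPf p B :=
  (exists_ringPf_lift p (frob_ringPf_bijective p) ((toRingPf p B).comp f)).choose

lemma ringPfMap_comp_toRingPf (f : A →+* B) :
    (ringPfMap p f).comp (toRingPf p A) = (toRingPf p B).comp f :=
  (exists_ringPf_lift p (frob_ringPf_bijective p) ((toRingPf p B).comp f)).choose_spec

@[simp]
lemma ringPfMap_toRingPf (f : A →+* B) (a : A) :
    ringPfMap p f (toRingPf p A a) = toRingPf p B (f a) :=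
  congr($(ringPfMap_comp_toRingPf p f) a)

lemma ringPfMap_id : ringPfMap p (RingHom.id A) = RingHom.id _ :=
  ringPf_hom_ext p (frob_ringPf_bijective p) (by rw [ringPfMap_comp_toRingPf]; rfl)

lemma ringPfMap_comp (f : A →+* B) (g : B →+* C) :
    ringPfMap p (g.comp f) = (ringPfMap p g).comp (ringPfMap p f) :=
  ringPf_hom_ext p (frob_ringPf_bijective p) (by
    ext a; simp)

/-- The perfect closure commutes with the localization at an element. -/
lemma ringPf_isLocalization (r : A) [Algebra A B] [IsLocalization.Away r B] :
    letI := (ringPfMap p (algebraMap A B)).toAlgebra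
    IsLocalization.Away (toRingPf p A r) (RingPf p B) := by
  let := (ringPfMap p (algebraMap A B)).toAlgebra
  have halg (x : A) : algebraMap (RingPf p A) (RingPf p B) (toRingPf p A x) =
      toRingPf p B (algebraMap A B x) := ringPfMap_toRingPf p _ x
  refine IsLocalization.Away.mk _ ?_ ?_ ?_
  · rw [halg]
    exact (IsLocalization.Away.algebraMap_isUnit r).map _
  · intro y
    obtain ⟨n, b, rfl⟩ := exists_ringPfι p y
    obtain ⟨m, a, h⟩ := IsLocalization.Away.surj r b
    refine ⟨m, ringPfι p n (r ^ (m * p ^ n - m) * a), ?_⟩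
    apply eq_of_pow_eq p (frob_ringPf_bijective p) n
    have hm : m ≤ m * p ^ n := Nat.le_mul_of_pos_right m (pow_pos hp.out.pos n)
    rw [mul_pow, ringPfι_pow, ← map_pow (algebraMap _ _) (ringPfι p n _), ringPfι_pow, halg, halg,
      map_mul (algebraMap A B), ← h]
    simp only [map_mul, map_pow]
    rw [← pow_mul, mul_left_comm, ← pow_add, Nat.sub_add_cancel hm]
  · intro x y hxy
    obtain ⟨n, a, ha⟩ := exists_pow_eq_toRingPf p (x - y)
    have h0 : toRingPf p B (algebraMap A B a) = 0 := by
      rw [← halg, ← ha, map_pow, map_sub, hxy, sub_self,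
        zero_pow (pow_ne_zero _ hp.out.ne_zero)]
    obtain ⟨m, hm⟩ := ringPfι_eq_zero p 0 _ h0
    rw [← map_pow, ← map_zero (algebraMap A B)] at hm
    obtain ⟨k, hk⟩ := IsLocalization.Away.exists_of_eq r hm
    refine ⟨k, ?_⟩
    rw [← sub_eq_zero, ← mul_sub]
    apply eq_of_pow_eq p (frob_ringPf_bijective p) (n + m)
    have hle : k ≤ k * p ^ (n + m) := Nat.le_mul_of_pos_right k (pow_pos hp.out.pos _)
    rw [mul_pow, pow_add p, pow_mul (x - y), ha, zero_pow (mul_ne_zero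
      (pow_ne_zero _ hp.out.ne_zero) (pow_ne_zero _ hp.out.ne_zero)), ← pow_add, ← pow_mul,
      ← Nat.sub_add_cancel hle, pow_add, mul_assoc, ← map_pow, ← map_pow, ← map_pow, ← map_mul,
      ← map_mul, hk]
    simp

end Rings

section Schemes

/-- A scheme on which `p = 0`, i.e. an `𝔽_p`-scheme (being one is a property, since
`Spec 𝔽_p → Spec ℤ` is a monomorphism; all morphisms of schemes are `𝔽_p`-morphisms). -/
class IsFpScheme (p : ℕ) (X : Scheme.{u}) : Prop where
  cast_eq_zero : (p : Γ(X, ⊤)) = 0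

lemma IsFpScheme.of_hom {p : ℕ} {X Y : Scheme.{u}} (f : X ⟶ Y) [IsFpScheme p Y] :
    IsFpScheme p X :=
  ⟨by rw [← map_natCast f.appTop.hom p, IsFpScheme.cast_eq_zero, map_zero]⟩

instance {p : ℕ} {X : Scheme.{u}} [IsFpScheme p X] (U : X.Opens) : IsFpRing p Γ(X, U) :=
  ⟨by rw [← map_natCast (X.presheaf.map (homOfLE (le_top : U ≤ ⊤)).op).hom p,
    IsFpScheme.cast_eq_zero, map_zero]⟩

instance {p : ℕ} (A : CommRingCat.{u}) [IsFpRing p A] : IsFpScheme p (Spec A) :=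
  ⟨by rw [← map_natCast (Scheme.ΓSpecIso A).inv.hom p, IsFpRing.cast_eq_zero, map_zero]⟩

instance {p : ℕ} (X : Scheme.{u}) [IsFpScheme p X] (U : X.Opens) : IsFpScheme p U :=
  .of_hom U.ι

variable (p : ℕ) [hp : Fact p.Prime]

/-- The Frobenius `F_X : X ⟶ X` of an `𝔽_p`-scheme as a morphism of ringed spaces: the identity on
the underlying topological space and `a ↦ a ^ p` on sections. -/
def absFrobPsh (X : Scheme.{u}) [IsFpScheme p X] : X.toPresheafedSpace ⟶ X.toPresheafedSpace where
  base := 𝟙 _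
  c := { app := fun U => CommRingCat.ofHom (frob p Γ(X, U.unop))
         naturality := fun U V i => by
          ext a
          exact (map_pow (X.presheaf.map i).hom a p).symm }

lemma absFrobPsh_stalkMap (X : Scheme.{u}) [IsFpScheme p X] (x : X)
    (s : X.presheaf.stalk x) :
    (absFrobPsh p X).stalkMap x s = (s ^ p : X.presheaf.stalk x) := by
  obtain ⟨U, hxU, a, rfl⟩ := X.presheaf.exists_germ_eq s
  refine (PresheafedSpace.stalkMap_germ_apply (absFrobPsh p X) U x hxU a).trans ?_
  exact map_pow (X.presheaf.germ U x hxU).hom a p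

/-- The absolute Frobenius `F_X : X ⟶ X` of an `𝔽_p`-scheme: the identity on the underlying
topological space and `a ↦ a ^ p` on sections. -/
def absFrob (X : Scheme.{u}) [IsFpScheme p X] : X ⟶ X where
  toHom := absFrobPsh p X
  prop x := ⟨fun s hs => by
    have h := absFrobPsh_stalkMap p X x s
    exact (isUnit_pow_iff (M := X.presheaf.stalk x) hp.out.ne_zero).mp ((congrArg IsUnit h).mp hs)⟩

variable {X Y : Scheme.{u}}

lemma absFrob_base_apply [IsFpScheme p X] (x : X) : absFrob p X x = x := rfl

lemma absFrob_preimage [IsFpScheme p X] (U : X.Opens) : absFrob p X ⁻¹ᵁ U = U := rfl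

lemma absFrob_app_apply [IsFpScheme p X] (U : X.Opens) (a : Γ(X, U)) :
    (absFrob p X).app U a = (show Γ(X, absFrob p X ⁻¹ᵁ U) from (a ^ p : Γ(X, U))) := rfl

/-- The absolute Frobenius commutes with every morphism. -/
lemma absFrob_naturality [IsFpScheme p X] [IsFpScheme p Y] (f : X ⟶ Y) :
    absFrob p X ≫ f = f ≫ absFrob p Y := by
  refine Scheme.Hom.ext rfl fun U => ?_
  refine (congrArg _ (X.presheaf.map_id _)).trans ?_
  refine (Category.comp_id _).trans ?_
  ext a
  exact (map_pow (f.app U).hom a p).symm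

/-- The absolute Frobenius of `Spec A` is induced by the Frobenius of `A`. -/
lemma absFrob_Spec (A : CommRingCat.{u}) [IsFpRing p A] :
    absFrob p (Spec A) = Spec.map (CommRingCat.ofHom (frob p A)) := by
  refine ext_of_isAffine ?_
  ext a
  obtain ⟨b, rfl⟩ := (Scheme.ΓSpecIso A).symm.commRingCatIsoToRingEquiv.surjective a
  change ((Scheme.ΓSpecIso A).inv b) ^ p = _
  have h := congr($(Scheme.ΓSpecIso_inv_naturality (CommRingCat.ofHom (frob p A))) b)
  simp only [CommRingCat.comp_apply] at h
  rw [← map_pow]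
  exact h

/-- An `𝔽_p`-scheme is perfect if its absolute Frobenius is an isomorphism. -/
class IsPerfect (X : Scheme.{u}) : Prop extends IsFpScheme p X where
  isIso_absFrob : IsIso (absFrob p X)

attribute [instance] IsPerfect.isIso_absFrob

lemma IsPerfect.frob_bijective (X : Scheme.{u}) [IsPerfect p X] (U : X.Opens) :
    Function.Bijective (frob p Γ(X, U)) :=
  ConcreteCategory.bijective_of_isIso ((absFrob p X).app U)

lemma IsPerfect.Spec (A : CommRingCat.{u}) [IsFpRing p A] (h : Function.Bijective (frob p A)) :
    IsPerfect p (Spec A) where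
  isIso_absFrob := by
    rw [absFrob_Spec]
    have : IsIso (CommRingCat.ofHom (frob p A)) :=
      (ConcreteCategory.isIso_iff_bijective _).mpr h
    infer_instance

lemma absFrob_restrict [IsFpScheme p X] (U : X.Opens) :
    (X.isoOfEq (absFrob_preimage p U)).inv ≫ (absFrob p X ∣_ U) = absFrob p U := by
  rw [← cancel_mono U.ι, absFrob_naturality, Category.assoc, morphismRestrict_ι,
    Scheme.isoOfEq_inv_ι_assoc]

instance IsPerfect.restrict [IsPerfect p X] (U : X.Opens) : IsPerfect p U where
  isIso_absFrob := by
    rw [← absFrob_restrict]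
    infer_instance

lemma IsPerfect.of_iso (e : X ≅ Y) [IsPerfect p X] : IsPerfect p Y where
  toIsFpScheme := .of_hom e.inv
  isIso_absFrob := by
    have : IsFpScheme p Y := .of_hom e.inv
    have h : absFrob p Y = e.inv ≫ absFrob p X ≫ e.hom := by
      rw [absFrob_naturality, e.inv_hom_id_assoc]
    rw [h]
    infer_instance

lemma IsPerfect.of_isOpenImmersion (f : X ⟶ Y) [IsOpenImmersion f] [IsPerfect p Y] :
    IsPerfect p X :=
  .of_iso p f.isoOpensRange.symm

lemma IsPerfect.of_openCover [IsFpScheme p X] (𝒰 : X.OpenCover) (h : ∀ i, IsPerfect p (𝒰.X i)) :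
    IsPerfect p X where
  isIso_absFrob := by
    refine (IsZariskiLocalAtTarget.iff_of_iSup_eq_top (P := .isomorphisms Scheme)
      (fun i => (𝒰.f i).opensRange) 𝒰.iSup_opensRange).mpr fun i => ?_
    have : IsPerfect p (𝒰.f i).opensRange := .of_iso p (𝒰.f i).isoOpensRange
    have h := absFrob_restrict p (𝒰.f i).opensRange
    rw [Iso.inv_comp_eq] at h
    rw [MorphismProperty.isomorphisms.iff, h]
    infer_instance


end Schemes

section Gluing

open Scheme.AffineZariskiSite

variable (p : ℕ) [hp : Fact p.Prime]

/-- The assignment `U ↦ Γ(Y, U)^pf` on the affine open subsets `U` of `Y`. -/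
noncomputable def pfDiagram (Y : Scheme.{u}) [IsFpScheme p Y] :
    Y.AffineZariskiSiteᵒᵖ ⥤ CommRingCat.{u} where
  obj U := .of (RingPf p Γ(Y, U.unop.toOpens))
  map {U V} i := CommRingCat.ofHom
    (ringPfMap p (Y.presheaf.map (homOfLE (toOpens_mono i.unop.le)).op).hom)
  map_id U := by
    refine CommRingCat.hom_ext ?_
    refine (congrArg (ringPfMap p) (congrArg CommRingCat.Hom.hom (Y.presheaf.map_id _))).trans ?_
    exact ringPfMap_id p
  map_comp {U V W} i j := by
    refine CommRingCat.hom_ext (Eq.trans ?_ (ringPfMap_comp p _ _))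
    refine congrArg (ringPfMap p) ?_
    rw [← CommRingCat.hom_comp, ← Functor.map_comp]
    rfl

/-- The maps `φ_{Γ(Y, U)} : Γ(Y, U) → Γ(Y, U)^pf`. -/
noncomputable def pfDiagramMap (Y : Scheme.{u}) [IsFpScheme p Y] :
    (toOpensFunctor Y).op ⋙ Y.presheaf ⟶ pfDiagram p Y where
  app U := CommRingCat.ofHom (toRingPf p Γ(Y, U.unop.toOpens))
  naturality U V i := by
    exact CommRingCat.hom_ext (ringPfMap_comp_toRingPf p
      (Y.presheaf.map (homOfLE (toOpens_mono i.unop.le)).op).hom).symm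

lemma coequifibered_pfDiagramMap (Y : Scheme.{u}) [IsFpScheme p Y] :
    (pfDiagramMap p Y).Coequifibered := by
  refine coequifibered_iff_forall_isLocalizationAway.mpr fun U r => ?_
  let : Algebra Γ(Y, U.1) Γ(Y, Y.basicOpen r) :=
    (Y.presheaf.map (homOfLE (Y.basicOpen_le r)).op).hom.toAlgebra
  have : IsLocalization.Away r Γ(Y, Y.basicOpen r) := U.2.isLocalization_basicOpen r
  exact ringPf_isLocalization p (B := Γ(Y, Y.basicOpen r)) r

/-- The gluing data of the affine schemes `Spec (Γ(Y, U)^pf)`, where `U` runs through the affine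
open subsets of `Y`. -/
noncomputable def pfGlueData (Y : Scheme.{u}) [IsFpScheme p Y] :
    (directedCover Y).RelativeGluingData :=
  relativeGluingData (coequifibered_pfDiagramMap p Y)

noncomputable instance (Y : Scheme.{u}) [IsFpScheme p Y] :
    ((pfGlueData p Y).functor ⋙ Scheme.forget).IsLocallyDirected :=
  Scheme.Cover.RelativeGluingData.instIsLocallyDirectedI₀CompFunctorForgetOfIsThin ..

/-- The inverse perfection `Y^pf` of an `𝔽_p`-scheme `Y`, obtained by globalizing `A ↦ A^pf`, i.e.
by gluing the affine schemes `Spec (Γ(Y, U)^pf)` for `U ⊆ Y` open affine. -/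
noncomputable def schemePf (Y : Scheme.{u}) [IsFpScheme p Y] : Scheme.{u} :=
  (pfGlueData p Y).glued

/-- The canonical morphism `φ_Y : Y^pf ⟶ Y`. -/
noncomputable def schemePfφ (Y : Scheme.{u}) [IsFpScheme p Y] : schemePf p Y ⟶ Y :=
  (pfGlueData p Y).toBase

/-- The open covering of `Y^pf` by the affine schemes `Spec (Γ(Y, U)^pf)`. -/
noncomputable def schemePfCover (Y : Scheme.{u}) [IsFpScheme p Y] : (schemePf p Y).OpenCover :=
  (pfGlueData p Y).cover

variable {Y : Scheme.{u}} [IsFpScheme p Y]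

instance : IsFpScheme p (schemePf p Y) := .of_hom (schemePfφ p Y)

variable (Y) in
/-- The open immersion of `Spec (Γ(Y, U)^pf)` into `Y^pf`. -/
noncomputable def schemePfChart (U : Y.AffineZariskiSite) :
    Spec (.of (RingPf p Γ(Y, U.toOpens))) ⟶ schemePf p Y :=
  (schemePfCover p Y).f U

instance (U : Y.AffineZariskiSite) : IsOpenImmersion (schemePfChart p Y U) :=
  (schemePfCover p Y).map_prop U


lemma schemePfChart_φ (U : Y.AffineZariskiSite) :
    schemePfChart p Y U ≫ schemePfφ p Y =
      Spec.map (CommRingCat.ofHom (toRingPf p Γ(Y, U.toOpens))) ≫ U.2.fromSpec :=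
  colimit.ι_desc _ _

lemma schemePfφ_preimage (U : Y.AffineZariskiSite) :
    schemePfφ p Y ⁻¹ᵁ U.toOpens = (schemePfChart p Y U).opensRange := by
  simpa using! (pfGlueData p Y).toBase_preimage_eq_opensRange_ι U

instance schemePf_isPerfect : IsPerfect p (schemePf p Y) :=
  .of_openCover p (schemePfCover p Y) fun U =>
    IsPerfect.Spec p (.of (RingPf p Γ(Y, Scheme.AffineZariskiSite.toOpens U)))
      (frob_ringPf_bijective p)

variable {p} in
/-- Uniqueness in the universal property, affine case. -/
lemma spec_hom_ext {Z : Scheme.{u}} [IsPerfect p Z] {A : Type u} [CommRing A] [IsFpRing p A]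
    {f g : Z ⟶ Spec (.of (RingPf p A))}
    (h : f ≫ Spec.map (CommRingCat.ofHom (toRingPf p A)) =
      g ≫ Spec.map (CommRingCat.ofHom (toRingPf p A))) : f = g := by
  have key (k : Z ⟶ Spec (.of (RingPf p A))) :
      ((Scheme.ΓSpecIso (.of (RingPf p A))).inv ≫ k.appTop).hom.comp (toRingPf p A) =
        ((Scheme.ΓSpecIso (.of A)).inv ≫
          (k ≫ Spec.map (CommRingCat.ofHom (toRingPf p A))).appTop).hom := by
    rw [Scheme.Hom.comp_appTop, ← Category.assoc, ← Scheme.ΓSpecIso_inv_naturality]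
    rfl
  refine ext_to_Spec ?_
  refine CommRingCat.hom_ext (ringPf_hom_ext p (IsPerfect.frob_bijective p Z ⊤) ?_)
  exact (key f).trans ((congrArg (fun m : Z ⟶ Spec (.of A) =>
    ((Scheme.ΓSpecIso (.of A)).inv ≫ m.appTop).hom) h).trans (key g).symm)

variable {p} in
/-- Existence in the universal property, affine case. -/
lemma exists_spec_lift {Z : Scheme.{u}} [IsPerfect p Z] {A : Type u} [CommRing A] [IsFpRing p A]
    (f : Z ⟶ Spec (.of A)) :
    ∃ g : Z ⟶ Spec (.of (RingPf p A)),
      g ≫ Spec.map (CommRingCat.ofHom (toRingPf p A)) = f := by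
  obtain ⟨l, hl⟩ := exists_ringPf_lift p (IsPerfect.frob_bijective p Z ⊤)
    ((Scheme.ΓSpecIso (.of A)).inv ≫ f.appTop).hom
  refine ⟨Z.toSpecΓ ≫ Spec.map (CommRingCat.ofHom l), ?_⟩
  rw [Category.assoc, ← Spec.map_comp, ← CommRingCat.ofHom_comp, hl, CommRingCat.ofHom_hom,
    Spec.map_comp, ← Scheme.toSpecΓ_naturality_assoc, toSpecΓ_SpecMap_ΓSpecIso_inv,
    Category.comp_id]

variable {Z : Scheme.{u}} [IsPerfect p Z]

variable {p} in
/-- Uniqueness in the universal property of `φ_Y : Y^pf ⟶ Y`. -/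
lemma schemePf_hom_ext {f g : Z ⟶ schemePf p Y} (h : f ≫ schemePfφ p Y = g ≫ schemePfφ p Y) :
    f = g := by
  refine Scheme.Cover.hom_ext (Z.openCoverOfIsOpenCover _
    (.comap (iSup_affineOpens_eq_top Y) (f ≫ schemePfφ p Y).base.1)) _ _ fun U => ?_
  let U' : Y.AffineZariskiSite := U
  let W : Z.Opens := (f ≫ schemePfφ p Y) ⁻¹ᵁ U'.toOpens
  change W.ι ≫ f = W.ι ≫ g
  have hf : Set.range (W.ι ≫ f) ⊆ Set.range (schemePfChart p Y U') := by
    rintro _ ⟨x, rfl⟩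
    have hx : (W.ι ≫ f) x ∈ schemePfφ p Y ⁻¹ᵁ U'.toOpens := x.2
    rw [schemePfφ_preimage] at hx
    exact hx
  have hg : Set.range (W.ι ≫ g) ⊆ Set.range (schemePfChart p Y U') := by
    rintro _ ⟨x, rfl⟩
    have hx : (g ≫ schemePfφ p Y) x.1 ∈ U'.toOpens := by rw [← h]; exact x.2
    change (W.ι ≫ g) x ∈ schemePfφ p Y ⁻¹ᵁ U'.toOpens at hx
    rw [schemePfφ_preimage] at hx
    exact hx
  rw [← IsOpenImmersion.lift_fac (schemePfChart p Y U') (W.ι ≫ f) hf,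
    ← IsOpenImmersion.lift_fac (schemePfChart p Y U') (W.ι ≫ g) hg]
  congr 1
  apply spec_hom_ext
  rw [← cancel_mono U'.2.fromSpec, Category.assoc, Category.assoc, ← schemePfChart_φ,
    IsOpenImmersion.lift_fac_assoc, IsOpenImmersion.lift_fac_assoc, Category.assoc,
    Category.assoc, h]

variable {p} in
/-- Existence in the universal property of `φ_Y : Y^pf ⟶ Y`. -/
lemma exists_schemePf_lift (ψ : Z ⟶ Y) : ∃ g : Z ⟶ schemePf p Y, g ≫ schemePfφ p Y = ψ := by
  let 𝒱 := Z.openCoverOfIsOpenCover _ (.comap (iSup_affineOpens_eq_top Y) ψ.base.1)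
  have H (U : 𝒱.I₀) : ∃ g : 𝒱.X U ⟶ schemePf p Y, g ≫ schemePfφ p Y = 𝒱.f U ≫ ψ := by
    let U' : Y.AffineZariskiSite := U
    let W : Z.Opens := ψ ⁻¹ᵁ U'.toOpens
    change ∃ g : W.toScheme ⟶ schemePf p Y, g ≫ schemePfφ p Y = W.ι ≫ ψ
    have hW : Set.range (W.ι ≫ ψ) ⊆ Set.range U'.2.fromSpec := by
      rw [U'.2.range_fromSpec]
      rintro _ ⟨x, rfl⟩
      exact x.2
    obtain ⟨g, hg⟩ := exists_spec_lift (p := p) (IsOpenImmersion.lift U'.2.fromSpec (W.ι ≫ ψ) hW)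
    refine ⟨g ≫ schemePfChart p Y U', ?_⟩
    rw [Category.assoc, schemePfChart_φ, reassoc_of% hg, IsOpenImmersion.lift_fac]
  choose g hg using H
  refine ⟨𝒱.glueMorphisms g fun U V => ?_, Scheme.Cover.hom_ext 𝒱 _ _ fun U => ?_⟩
  · have : IsPerfect p (pullback (𝒱.f U) (𝒱.f V)) :=
      .of_isOpenImmersion p (pullback.fst (𝒱.f U) (𝒱.f V) ≫ 𝒱.f U)
    apply schemePf_hom_ext
    rw [Category.assoc, Category.assoc, hg, hg, pullback.condition_assoc]
  · rw [Scheme.Cover.ι_glueMorphisms_assoc, hg]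

end Gluing

section Relative

lemma isFpScheme_left (p : ℕ) (S : Scheme.{u}) [IsFpScheme p S] (X : Over S) :
    IsFpScheme p X.left := .of_hom X.hom

variable (p : ℕ) [hp : Fact p.Prime]

/-- `Spec k` is perfect for a perfect field `k` of characteristic `p`. -/
instance isPerfect_Spec_field (k : Type u) [Field k] [CharP k p] [PerfectField k] :
    IsPerfect p (Spec (.of k)) := by
  have : IsFpRing p k := ⟨CharP.cast_eq_zero k p⟩
  have : ExpChar k p := .prime hp.out
  have : PerfectRing k p := PerfectField.toPerfectRing p
  exact IsPerfect.Spec p (.of k) (PerfectRing.bijective_frobenius (R := k) (p := p))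

variable (S : Scheme.{u})

/-- The property of an `S`-scheme of being a perfect scheme. -/
def isPerfectOver : ObjectProperty (Over S) := fun X => IsPerfect p X.left

/-- The category of perfect `S`-schemes, a full subcategory of the category of `S`-schemes. -/
abbrev Perf : Type (u + 1) := (isPerfectOver p S).FullSubcategory

instance Perf.isPerfect (X : Perf p S) : IsPerfect p X.obj.left := X.property

instance isPerfectOver_isClosedUnderLimits [IsPerfect p S] (J : Type) [SmallCategory J] :
    (isPerfectOver p S).IsClosedUnderLimitsOfShape J where
  limitsOfShape_le := by
    rintro X ⟨⟨⟨D, π, hl⟩, hD⟩⟩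
    change ∀ j, IsPerfect p (D.obj j).left at hD
    have hX : IsFpScheme p X.left := isFpScheme_left p S X
    have key {j j' : J} (f : j ⟶ j') : inv (absFrob p (D.obj j).left) ≫ (D.map f).left =
        (D.map f).left ≫ inv (absFrob p (D.obj j').left) := by
      rw [IsIso.inv_comp_eq, ← Category.assoc, absFrob_naturality, Category.assoc,
        IsIso.hom_inv_id, Category.comp_id]
    let X' : Over S := Over.mk (X.hom ≫ inv (absFrob p S))
    let c : Cone D :=
      { pt := X'
        π :=
          { app := fun j => Over.homMk ((π.app j).left ≫ inv (absFrob p (D.obj j).left)) (by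
              change _ = X.hom ≫ inv (absFrob p S)
              rw [Category.assoc, IsIso.eq_comp_inv, Category.assoc, Category.assoc,
                ← absFrob_naturality, IsIso.inv_hom_id_assoc]
              exact Over.w (π.app j))
            naturality := fun j j' f => by
              ext1
              have := congr($(π.naturality f).left)
              simp only [Functor.const_obj_map, Over.comp_left] at this
              simp [key, ← this] } }
    let L : X' ⟶ X := hl.lift c
    have hL (j : J) : L.left ≫ (π.app j).left =
        (π.app j).left ≫ inv (absFrob p (D.obj j).left) := congr($(hl.fac c j).left)
    have hLS : L.left ≫ X.hom = X.hom ≫ inv (absFrob p S) := Over.w L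
    have ext {g : X.left ⟶ X.left} (h1 : g ≫ X.hom = X.hom)
        (h2 : ∀ j, g ≫ (π.app j).left = (π.app j).left) : g = 𝟙 _ := by
      have : (Over.homMk g h1 : X ⟶ X) = 𝟙 X := hl.hom_ext fun j => by
        ext1
        simpa using h2 j
      exact congr($(this).left)
    have hcomm : absFrob p X.left ≫ L.left = L.left ≫ absFrob p X.left :=
      absFrob_naturality p (X := X.left) (Y := X.left) L.left
    have h1 : L.left ≫ absFrob p X.left = 𝟙 X.left := by
      refine ext ?_ fun j => ?_
      · rw [Category.assoc, absFrob_naturality, ← Category.assoc, hLS, Category.assoc,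
          IsIso.inv_hom_id, Category.comp_id]
      · rw [Category.assoc, absFrob_naturality, ← Category.assoc, hL, Category.assoc,
          IsIso.inv_hom_id, Category.comp_id]
    exact { toIsFpScheme := hX, isIso_absFrob := ⟨L.left, hcomm.trans h1, h1⟩ }

variable {S}

/-- The inverse perfection `Y^pf` of an `S`-scheme `Y`, with structure morphism
`Y^pf ⟶ Y ⟶ S`. -/
noncomputable def pfObj [IsPerfect p S] (Y : Over S) : Perf p S :=
  haveI := isFpScheme_left p S Y
  ⟨Over.mk (schemePfφ p Y.left ≫ Y.hom), inferInstanceAs (IsPerfect p (schemePf p Y.left))⟩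

/-- The canonical morphism of `S`-schemes `φ_Y : Y^pf ⟶ Y`. -/
noncomputable def pfφ [IsPerfect p S] (Y : Over S) : (pfObj p Y).obj ⟶ Y :=
  haveI := isFpScheme_left p S Y
  Over.homMk (schemePfφ p Y.left)

variable {p} in
lemma pf_hom_ext [IsPerfect p S] {Y : Over S} {Z : Perf p S} {f g : Z ⟶ pfObj p Y}
    (h : f.hom ≫ pfφ p Y = g.hom ≫ pfφ p Y) : f = g := by
  have := isFpScheme_left p S Y
  ext
  exact schemePf_hom_ext (congr($(h).left))

variable {p} in
lemma exists_pf_lift [IsPerfect p S] {Y : Over S} {Z : Perf p S} (ψ : Z.obj ⟶ Y) :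
    ∃ g : Z ⟶ pfObj p Y, g.hom ≫ pfφ p Y = ψ := by
  have := isFpScheme_left p S Y
  obtain ⟨g, hg⟩ := exists_schemePf_lift (p := p) ψ.left
  refine ⟨ObjectProperty.homMk (Over.homMk g ?_), ?_⟩
  · change g ≫ schemePfφ p Y.left ≫ Y.hom = Z.obj.hom
    rw [reassoc_of% hg, Over.w]
  · ext1
    exact hg

/-- The morphism `Z ⟶ Y^pf` of perfect `S`-schemes corresponding to `Z ⟶ Y`. -/
noncomputable def pfLift [IsPerfect p S] {Y : Over S} {Z : Perf p S} (ψ : Z.obj ⟶ Y) :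
    Z ⟶ pfObj p Y :=
  (exists_pf_lift ψ).choose

@[simp]
lemma pfLift_φ [IsPerfect p S] {Y : Over S} {Z : Perf p S} (ψ : Z.obj ⟶ Y) :
    (pfLift p ψ).hom ≫ pfφ p Y = ψ :=
  (exists_pf_lift ψ).choose_spec

variable (S)

/-- The inverse perfection functor from `S`-schemes to perfect `S`-schemes, for `S` perfect. -/
noncomputable def pf [IsPerfect p S] : Over S ⥤ Perf p S where
  obj Y := pfObj p Y
  map {Y Y'} f := pfLift p (pfφ p Y ≫ f)
  map_id Y := pf_hom_ext (by simp)
  map_comp f g := pf_hom_ext (by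
    rw [pfLift_φ, ObjectProperty.FullSubcategory.comp_hom, Category.assoc, pfLift_φ,
      ← Category.assoc, ← Category.assoc, pfLift_φ])

/-- The morphisms `φ_Y : Y^pf ⟶ Y` are natural. -/
lemma pf_map_φ [IsPerfect p S] {Y Y' : Over S} (f : Y ⟶ Y') :
    ((pf p S).map f).hom ≫ pfφ p Y' = pfφ p Y ≫ f :=
  pfLift_φ p _

/-- The universal property of the inverse perfection: composition with `φ_Y` is a bijection
from the morphisms `Z ⟶ Y^pf` to the morphisms `Z ⟶ Y`, for `Z` perfect. -/
noncomputable def pfAdjunction [IsPerfect p S] : (isPerfectOver p S).ι ⊣ pf p S :=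
  Adjunction.mkOfHomEquiv
    { homEquiv := fun Z Y =>
        { toFun := fun ψ => pfLift p ψ
          invFun := fun g => g.hom ≫ pfφ p Y
          left_inv := fun ψ => pfLift_φ p ψ
          right_inv := fun g => pf_hom_ext (pfLift_φ p _) }
      homEquiv_naturality_left_symm := fun f g => by
        exact Category.assoc f.hom g.hom (pfφ p _)
      homEquiv_naturality_right := fun f g => pf_hom_ext (by
        refine (pfLift_φ p _).trans ?_
        refine Eq.trans ?_ (Category.assoc (pfLift p f).hom ((pf p S).map g).hom (pfφ p _)).symm
        refine Eq.trans ?_ (congrArg ((pfLift p f).hom ≫ ·) (pf_map_φ p S g)).symm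
        exact (congrArg (· ≫ g) (pfLift_φ p f).symm).trans (Category.assoc _ _ _)) }

instance [IsPerfect p S] : PreservesFiniteProducts (pf p S) :=
  have := (pfAdjunction p S).rightAdjoint_preservesLimits
  inferInstance

/-- Inverse perfection commutes with finite products. -/
noncomputable instance pfMonoidal [IsPerfect p S] : (pf p S).Monoidal :=
  .ofChosenFiniteProducts _

/-- The inverse perfection of `S`-group schemes. -/
noncomputable abbrev pfGrp [IsPerfect p S] : Grp (Over S) ⥤ Grp (Perf p S) := (pf p S).mapGrp

end Relative

section Exactness

/-- The fpqc topology on the category of `S`-schemes. -/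
noncomputable def fpqcOver (S : Scheme.{u}) : GrothendieckTopology (Over S) :=
  (Scheme.fpqcPrecoverage.comap (Over.forget S)).toGrothendieck

/-- The fpqc topology on the category of perfect `S`-schemes. -/
noncomputable def fpqcPerf (p : ℕ) [Fact p.Prime] (S : Scheme.{u}) :
    GrothendieckTopology (Perf p S) :=
  (Scheme.fpqcPrecoverage.comap ((isPerfectOver p S).ι ⋙ Over.forget S)).toGrothendieck

/-- A sequence `1 ⟶ F ⟶ G ⟶ H ⟶ 1` of group objects of `C` is exact for a topology `J` on `C` if
the morphism of presheaves of groups `Hom(-, F) ⟶ Hom(-, G)` identifies `Hom(-, F)` with the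
kernel of `Hom(-, G) ⟶ Hom(-, H)`, and the latter is locally surjective for `J`. -/
structure IsShortExact {C : Type*} [Category* C] [CartesianMonoidalCategory C]
    (J : GrothendieckTopology C) {F G H : Grp C} (i : F ⟶ G) (q : G ⟶ H) : Prop where
  injective (T : Cᵒᵖ) : Function.Injective ((yonedaGrp.map i).app T).hom
  range_eq_ker (T : Cᵒᵖ) : ((yonedaGrp.map i).app T).hom.range = ((yonedaGrp.map q).app T).hom.ker
  locallySurjective : Presheaf.IsLocallySurjective J (yonedaGrp.map q)

end Exactness

end InversePerfection

/-!
Let `T` be a perfect `k`-scheme. By the universal property of `φ_Y : Y^pf ⟶ Y`, composition with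
`φ_Y` is a bijection from `Hom(T, Y^pf)` to `Hom(T, Y)`. It is natural in `Y` and compatible with
the group structures, so the exactness of `1 → F^pf(T) → G^pf(T) → H^pf(T)` is that of
`1 → F(T) → G(T) → H(T)`.

For local surjectivity, a section of `H^pf` over `T`, that is, a morphism `T ⟶ H`, lifts to `G`
on some fpqc covering `X i ⟶ T`. The schemes `X i` need not be perfect, but `T` is covered by the
`X i ^pf` (`ofArrows_schemePfφ_comp_mem_fpqcPrecoverage`), over which the section lifts to `G^pf`:

* `φ : X^pf ⟶ X` is affine and surjective, so composing with it keeps a covering family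
  quasi-compact and jointly surjective;
* if `X` is flat over the perfect scheme `T`, so is `X^pf` (`flat_schemePfφ_comp`). For rings, `B^pf`
  is the colimit of copies of `B` along Frobenius, and the `n`-th copy, as a module over the perfect
  ring `A`, is `B` restricted along the automorphism `a ↦ a ^ p ^ n` of `A`, hence flat. The proof of
  `flat_ringPf` runs this argument through the equational criterion for flatness: a relation in
  `B^pf` is a relation in `B` with coefficients raised to the power `p ^ n`, and the coefficients
  witnessing its triviality have `p ^ n`-th roots in `A`.
-/

namespace InversePerfection

/-! ### Perfect closures of flat algebras -/

section Rings

variable (p : ℕ) [hp : Fact p.Prime]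

lemma exists_ringPfι_of_finite {B : Type u} [CommRing B] [IsFpRing p B] {ι : Type*} [Finite ι]
    (x : ι → RingPf p B) : ∃ (n : ℕ) (b : ι → B), ∀ i, ringPfι p n (b i) = x i := by
  cases nonempty_fintype ι
  choose n b h using fun i => exists_ringPfι p (x i)
  refine ⟨Finset.univ.sup n, fun i => b i ^ p ^ (Finset.univ.sup n - n i), fun i => ?_⟩
  obtain ⟨m, hm⟩ := Nat.exists_eq_add_of_le (Finset.le_sup (f := n) (Finset.mem_univ i))
  simp only [hm, Nat.add_sub_cancel_left]
  rw [ringPfι_add_pow, h]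

lemma ringPfι_pow_eq_toRingPf {B : Type u} [CommRing B] [IsFpRing p B] (n : ℕ) (b : B) :
    ringPfι p n (b ^ p ^ n) = toRingPf p B b := by
  rw [toRingPf, ← ringPfι_add_pow p 0 n, zero_add]

/-- If `A` is perfect, then the `n`-th copy of a flat `A`-algebra `B` in the system defining
`B^pf` is flat over `A`, so `B^pf` is flat. -/
lemma flat_ringPf {A B : Type u} [CommRing A] [IsFpRing p A] [CommRing B] [IsFpRing p B]
    (hA : Function.Bijective (frob p A)) (f : A →+* B) [Module A B] [Module.Flat A B]
    [Module A (RingPf p B)] (smulB : ∀ (r : A) (s : B), r • s = f r * s)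
    (smulPf : ∀ (r : A) (s : RingPf p B), r • s = toRingPf p B (f r) * s) :
    Module.Flat A (RingPf p B) := by
  refine Module.Flat.of_forall_isTrivialRelation fun {l a x} h => ?_
  obtain ⟨n, b, hb⟩ := exists_ringPfι_of_finite p x
  -- The relation, read in the `n`-th copy of `B`, holds after raising it to a power of `p`.
  have h0 : ringPfι p n (∑ i, f (a i) ^ p ^ n * b i) = 0 := by
    simp only [smulPf] at h
    rw [← h, map_sum]
    refine Finset.sum_congr rfl fun i _ => ?_
    rw [map_mul, ringPfι_pow_eq_toRingPf, hb]
  obtain ⟨m, hm⟩ := ringPfι_eq_zero p n _ h0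
  have hrel : ∑ i, (a i ^ p ^ (n + m)) • (b i ^ p ^ m) = 0 := by
    rw [← frobPow_apply, map_sum] at hm
    rw [← hm]
    refine Finset.sum_congr rfl fun i _ => ?_
    rw [smulB, frobPow_apply, mul_pow, map_pow, ← pow_mul, pow_add]
  obtain ⟨k, c, y, hy, hc⟩ := Module.Flat.isTrivialRelation_of_sum_smul_eq_zero hrel
  choose d hd using fun i j => (frobPow_bijective p hA (n + m)).2 (c i j)
  simp only [frobPow_apply] at hd
  refine ⟨k, d, fun j => ringPfι p (n + m) (y j), fun i => ?_, fun j => ?_⟩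
  · rw [← hb, ← ringPfι_add_pow p n m]
    refine (congrArg _ (hy i)).trans ?_
    rw [map_sum]
    refine Finset.sum_congr rfl fun j _ => ?_
    rw [smulB, smulPf, ← hd, map_mul, map_pow f, ringPfι_pow_eq_toRingPf]
  · apply eq_of_pow_eq p hA (n + m)
    rw [← frobPow_apply, map_sum, zero_pow (pow_ne_zero _ hp.out.ne_zero), ← hc j]
    refine Finset.sum_congr rfl fun i _ => ?_
    rw [frobPow_apply, mul_pow, hd]

lemma flat_toRingPf_comp {A B : Type u} [CommRing A] [IsFpRing p A] [CommRing B] [IsFpRing p B]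
    (hA : Function.Bijective (frob p A)) {f : A →+* B} (hf : f.Flat) :
    ((toRingPf p B).comp f).Flat :=
  letI : Module A B := f.toAlgebra.toModule
  haveI : Module.Flat A B := hf
  letI : Module A (RingPf p B) := ((toRingPf p B).comp f).toAlgebra.toModule
  flat_ringPf p hA f (fun _ _ => rfl) (fun _ _ => rfl)

lemma surjective_comap_toRingPf (A : Type u) [CommRing A] [IsFpRing p A] :
    Function.Surjective (PrimeSpectrum.comap (toRingPf p A)) := by
  refine (PrimeSpectrum.isHomeomorph_comap (toRingPf p A) (fun x => ?_) fun a ha => ?_).surjective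
  · obtain ⟨n, a, h⟩ := exists_pow_eq_toRingPf p x
    exact ⟨p ^ n, pow_pos hp.out.pos n, a, h.symm⟩
  · obtain ⟨m, hm⟩ := ringPfι_eq_zero p 0 a ha
    exact ⟨p ^ m, hm⟩

end Rings

/-! ### Inverse perfection of fpqc coverings -/

section Schemes

open Scheme.AffineZariskiSite

variable (p : ℕ) [hp : Fact p.Prime] (Y : Scheme.{u}) [IsFpScheme p Y]

instance : IsAffineHom (schemePfφ p Y) where
  isAffine_preimage U hU := by
    have h : schemePfφ p Y ⁻¹ᵁ U = _ := schemePfφ_preimage p (⟨U, hU⟩ : Y.AffineZariskiSite)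
    have : IsOpenImmersion (schemePfChart p Y (⟨U, hU⟩ : Y.AffineZariskiSite)) :=
      (schemePfCover p Y).map_prop (⟨U, hU⟩ : Y.AffineZariskiSite)
    rw [h]
    exact isAffineOpen_opensRange (schemePfChart p Y (⟨U, hU⟩ : Y.AffineZariskiSite))

instance : Surjective (schemePfφ p Y) where
  surj y := by
    obtain ⟨_, ⟨U, hU, rfl⟩, hy, -⟩ :=
      Y.isBasis_affineOpens.exists_subset_of_mem_open (Set.mem_univ y) isOpen_univ
    let U' : Y.AffineZariskiSite := ⟨U, hU⟩
    have hy' : y ∈ Set.range hU.fromSpec := by rwa [hU.range_fromSpec]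
    obtain ⟨z, rfl⟩ := hy'
    obtain ⟨w, rfl⟩ := surjective_comap_toRingPf p Γ(Y, U) z
    refine ⟨schemePfChart p Y U' w, ?_⟩
    exact congr($(schemePfChart_φ p U') w)

variable {Y}

/-- If `T` is perfect and `Y` is flat over `T`, then so is `Y^pf`. -/
lemma flat_schemePfφ_comp {T : Scheme.{u}} [IsPerfect p T] (f : Y ⟶ T) [Flat f] :
    Flat (schemePfφ p Y ≫ f) := by
  have H (x : schemePf p Y) : ∃ (V : T.Opens) (_ : IsAffineOpen V) (U : Y.AffineZariskiSite),
      U.toOpens ≤ f ⁻¹ᵁ V ∧ schemePfφ p Y x ∈ U.toOpens := by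
    obtain ⟨_, ⟨V, hV, rfl⟩, hxV, -⟩ := T.isBasis_affineOpens.exists_subset_of_mem_open
      (Set.mem_univ (f (schemePfφ p Y x))) isOpen_univ
    obtain ⟨_, ⟨U, hU, rfl⟩, hxU, hUV⟩ := Y.isBasis_affineOpens.exists_subset_of_mem_open
      (show schemePfφ p Y x ∈ (f ⁻¹ᵁ V : Set Y) from hxV) (f ⁻¹ᵁ V).isOpen
    exact ⟨V, hV, ⟨U, hU⟩, hUV, hxU⟩
  choose V hV U hUV hxU using H
  have : IsZariskiLocalAtSource @Flat :=
    HasRingHomProperty.instIsZariskiLocalAtSource (Q := RingHom.Flat)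
  refine IsZariskiLocalAtSource.of_iSup_eq_top (P := @Flat)
    (fun x => (schemePfChart p Y (U x)).opensRange) ?_ fun x => ?_
  · refine top_le_iff.mp fun x _ => TopologicalSpace.Opens.mem_iSup.mpr ⟨x, ?_⟩
    rw [← schemePfφ_preimage]
    exact hxU x
  · have hflat : ((toRingPf p Γ(Y, (U x).toOpens)).comp
        (f.appLE (V x) (U x).toOpens (hUV x)).hom).Flat :=
      flat_toRingPf_comp p (IsPerfect.frob_bijective p T (V x))
        (HasRingHomProperty.appLE @Flat f inferInstance ⟨V x, hV x⟩ (U x) (hUV x))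
    have hSpec : Flat (Spec.map (f.appLE (V x) (U x).toOpens (hUV x) ≫
        CommRingCat.ofHom (toRingPf p Γ(Y, (U x).toOpens)))) := Flat.SpecMap_iff.mpr hflat
    have hc : schemePfChart p Y (U x) ≫ schemePfφ p Y ≫ f =
        Spec.map (f.appLE (V x) (U x).toOpens (hUV x) ≫
          CommRingCat.ofHom (toRingPf p Γ(Y, (U x).toOpens))) ≫ (hV x).fromSpec := by
      rw [← Category.assoc, schemePfChart_φ, Category.assoc, Spec.map_comp, Category.assoc,
        (hV x).SpecMap_appLE_fromSpec f (U x).2 (hUV x)]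
    rw [← Scheme.Hom.isoOpensRange_inv_comp, Category.assoc, hc]
    infer_instance

/-- The inverse perfection of an fpqc covering of a perfect scheme is an fpqc covering. -/
lemma ofArrows_schemePfφ_comp_mem_fpqcPrecoverage {T : Scheme.{u}} [IsPerfect p T] {ι : Type*}
    {X : ι → Scheme.{u}} [∀ i, IsFpScheme p (X i)] {f : ∀ i, X i ⟶ T}
    (h : Presieve.ofArrows X f ∈ Scheme.fpqcPrecoverage T) :
    Presieve.ofArrows (fun i => schemePf p (X i)) (fun i => schemePfφ p (X i) ≫ f i) ∈
      Scheme.fpqcPrecoverage T := by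
  obtain ⟨hqc, hflat⟩ := h
  replace hflat := (Scheme.ofArrows_mem_precoverage_iff (P := @Flat)).mp hflat
  refine ⟨?_, (Scheme.ofArrows_mem_precoverage_iff (P := @Flat)).mpr ⟨fun t => ?_, fun i => ?_⟩⟩
  · have := Precoverage.comp_mem_coverings (J := Scheme.qcPrecoverage) f hqc
      (σ := fun _ => PUnit.{1}) (fun i _ => schemePfφ p (X i)) fun i => by
        rw [Presieve.ofArrows_pUnit]
        exact (schemePfφ p (X i)).singleton_mem_qcPrecoverage
    convert this using 1
    refine le_antisymm ?_ ?_
    · rw [Presieve.ofArrows_le_iff]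
      exact fun i => ⟨(⟨i, ⟨⟩⟩ : Σ _ : ι, PUnit.{1})⟩
    · rw [Presieve.ofArrows_le_iff]
      exact fun i => ⟨i.1⟩
  · obtain ⟨i, x, rfl⟩ := hflat.1 t
    obtain ⟨y, rfl⟩ := (schemePfφ p (X i)).surjective x
    exact ⟨i, y, by simp⟩
  · have := hflat.2 i
    exact flat_schemePfφ_comp p (f i)

end Schemes

/-! ### Exact sequences of group schemes -/

section Exactness

variable (S : Scheme.{u})

/-- An fpqc covering sieve of an `S`-scheme contains a single fpqc covering family. -/
lemma mem_fpqcOver_iff {X : Over S} {W : Sieve X} :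
    W ∈ fpqcOver S X ↔
      ∃ R ∈ Scheme.fpqcPrecoverage.comap (Over.forget S) X, R ≤ W := by
  have : (Scheme.fpqcPrecoverage.comap (Over.forget S)).HasPullbacks :=
    ⟨fun _ _ => inferInstance⟩
  exact Precoverage.mem_toGrothendieck_iff_of_isStableUnderComposition

variable (p : ℕ) [hp : Fact p.Prime] [IsPerfect p S]

variable {S}

/-- The bijection `Hom(T, Y^pf) ≃ Hom(T, Y)` is natural in `Y`. -/
lemma comp_pf_map_φ {Y Y' : Over S} (f : Y ⟶ Y') {T : Perf p S} (x : T ⟶ pfObj p Y) :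
    (x ≫ (pf p S).map f).hom ≫ pfφ p Y' = (x.hom ≫ pfφ p Y) ≫ f := by
  refine (Category.assoc x.hom ((pf p S).map f).hom (pfφ p Y')).trans ?_
  exact (congrArg (x.hom ≫ ·) (pf_map_φ p S f)).trans (Category.assoc _ _ _).symm

open MonObj in
/-- The bijection `Hom(T, M^pf) ≃ Hom(T, M)` preserves the unit. -/
lemma one_pf_φ {T : Perf p S} (M : Grp (Over S)) :
    (1 : T ⟶ ((pfGrp p S).obj M).X).hom ≫ pfφ p M.X = (1 : T.obj ⟶ M.X) := by
  let e : T ⟶ pfObj p (MonoidalCategoryStruct.tensorUnit (Over S)) :=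
    SemiCartesianMonoidalCategory.toUnit T ≫ Functor.LaxMonoidal.ε (pf p S)
  have h : (e ≫ (pf p S).map η[M.X]).hom ≫ pfφ p M.X = (e.hom ≫ pfφ p _) ≫ η[M.X] :=
    comp_pf_map_φ p η[M.X] e
  have he : e.hom ≫ pfφ p _ = SemiCartesianMonoidalCategory.toUnit T.obj :=
    Subsingleton.elim _ _
  rw [he] at h
  exact (congrArg (fun f : T ⟶ pfObj p M.X => f.hom ≫ pfφ p M.X)
    (Category.assoc _ _ _).symm).trans h

open MonObj in
lemma comp_pf_map_eq_one_iff {M N : Grp (Over S)} (q : M ⟶ N) {T : Perf p S}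
    (y : T ⟶ pfObj p M.X) :
    y ≫ (pf p S).map q.hom.hom = (1 : T ⟶ ((pfGrp p S).obj N).X) ↔
      (y.hom ≫ pfφ p M.X) ≫ q.hom.hom = 1 :=
  ⟨fun e => (comp_pf_map_φ p q.hom.hom y).symm.trans
      ((congrArg (fun f : T ⟶ pfObj p N.X => f.hom ≫ pfφ p N.X) e).trans (one_pf_φ p N)),
    fun e => pf_hom_ext ((comp_pf_map_φ p q.hom.hom y).trans (e.trans (one_pf_φ p N).symm))⟩

/-- If a sieve `W` on a perfect `S`-scheme `T` is covering for the fpqc topology on all `S`-schemes,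
then the morphisms from perfect schemes that lie in `W` form a covering sieve: they contain the
inverse perfection of any fpqc covering contained in `W`. -/
lemma functorPullback_mem_fpqcPerf {T : Perf p S} {W : Sieve T.obj} (hW : W ∈ fpqcOver S T.obj) :
    W.functorPullback (isPerfectOver p S).ι ∈ fpqcPerf p S T := by
  obtain ⟨R, hR, hRW⟩ := (mem_fpqcOver_iff S).mp hW
  obtain ⟨ι, X, f, rfl⟩ := R.exists_eq_ofArrows
  rw [Precoverage.mem_comap_iff, Presieve.map_ofArrows] at hR
  have (i : ι) : IsFpScheme p (X i).left := isFpScheme_left p S (X i)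
  have hT : IsPerfect p T.obj.left := T.property
  let g (i : ι) : pfObj p (X i) ⟶ T := ObjectProperty.homMk (pfφ p (X i) ≫ f i)
  refine GrothendieckTopology.superset_covering _
    (S := Sieve.generate (Presieve.ofArrows (fun i => pfObj p (X i)) g)) ?_ ?_
  · rw [Sieve.generate_le_iff, Presieve.ofArrows_le_iff]
    exact fun i => W.downward_closed (hRW _ _ ⟨i⟩) (pfφ p (X i))
  · refine Precoverage.generate_mem_toGrothendieck ?_
    rw [Precoverage.mem_comap_iff, Presieve.map_ofArrows]
    exact ofArrows_schemePfφ_comp_mem_fpqcPrecoverage p (T := T.obj.left) hR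

open MonObj in
/-- Inverse perfection preserves exactness for the fpqc topology. -/
lemma IsShortExact.pfGrp_map {F G H : Grp (Over S)} {i : F ⟶ G} {q : G ⟶ H}
    (h : IsShortExact (fpqcOver S) i q) :
    IsShortExact (fpqcPerf p S) ((pfGrp p S).map i) ((pfGrp p S).map q) := by
  -- Exactness of `1 → F → G → H`, for the points with values in a perfect scheme `T`.
  have inj (T : Perf p S) {x y : T.obj ⟶ F.X} (hxy : x ≫ i.hom.hom = y ≫ i.hom.hom) : x = y :=
    h.injective (op T.obj) hxy
  have ker (T : Perf p S) (y : T.obj ⟶ G.X) :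
      (∃ x : T.obj ⟶ F.X, x ≫ i.hom.hom = y) ↔ y ≫ q.hom.hom = 1 :=
    SetLike.ext_iff.mp (h.range_eq_ker (op T.obj)) y
  refine ⟨fun T x y hxy => ?_, fun T => ?_, ⟨fun {T} s => ?_⟩⟩
  · change T.unop ⟶ pfObj p F.X at x y
    change x ≫ (pf p S).map i.hom.hom = y ≫ (pf p S).map i.hom.hom at hxy
    refine pf_hom_ext (inj T.unop ?_)
    exact (comp_pf_map_φ p i.hom.hom x).symm.trans
      ((congrArg (fun f : T.unop ⟶ pfObj p G.X => f.hom ≫ pfφ p G.X) hxy).trans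
        (comp_pf_map_φ p i.hom.hom y))
  · refine SetLike.ext fun y => ?_
    change T.unop ⟶ ((pfGrp p S).obj G).X at y
    refine Iff.trans ?_ ((ker T.unop (y.hom ≫ pfφ p G.X)).trans
      (comp_pf_map_eq_one_iff p q y).symm)
    change (∃ x : T.unop ⟶ pfObj p F.X, x ≫ (pf p S).map i.hom.hom = y) ↔ _
    constructor
    · rintro ⟨x, rfl⟩
      exact ⟨x.hom ≫ pfφ p F.X, (comp_pf_map_φ p i.hom.hom x).symm⟩
    · rintro ⟨x, hx⟩
      refine ⟨pfLift p x, pf_hom_ext ?_⟩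
      exact (comp_pf_map_φ p i.hom.hom (pfLift p x)).trans
        ((congrArg (· ≫ i.hom.hom) (pfLift_φ p x)).trans hx)
  · change T ⟶ pfObj p H.X at s
    have hs := h.locallySurjective.imageSieve_mem (U := T.obj) (s.hom ≫ pfφ p H.X)
    refine GrothendieckTopology.superset_covering _ ?_ (functorPullback_mem_fpqcPerf p hs)
    rintro T' g ⟨t, ht⟩
    change T'.obj ⟶ G.X at t
    change t ≫ q.hom.hom = g.hom ≫ s.hom ≫ pfφ p H.X at ht
    refine ⟨(pfLift p t : T' ⟶ pfObj p G.X), ?_⟩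
    change pfLift p t ≫ (pf p S).map q.hom.hom = g ≫ s
    refine pf_hom_ext ((comp_pf_map_φ p q.hom.hom (pfLift p t)).trans ?_)
    rw [pfLift_φ, ht]
    exact (Category.assoc g.hom s.hom (pfφ p H.X)).symm

end Exactness

end InversePerfection

theorem mainTheorem1 (p : ℕ) [Fact p.Prime] (k : Type u) [Field k] [CharP k p] [PerfectField k]
    {F G H : Grp (Over (Spec (.of k)))} (i : F ⟶ G) (q : G ⟶ H)
    (h : InversePerfection.IsShortExact (InversePerfection.fpqcOver (Spec (.of k))) i q) :
    InversePerfection.IsShortExact (InversePerfection.fpqcPerf p (Spec (.of k)))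
      ((InversePerfection.pfGrp p (Spec (.of k))).map i)
      ((InversePerfection.pfGrp p (Spec (.of k))).map q) :=
  h.pfGrp_map p
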